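/- Let $\mathbb{F}$ be a field of characteristic different from $2$. A unital associative $\mathbb{F}$-algebra $A$ is called a locally matrix algebra if every finite subset of $A$ is contained in a subalgebra isomorphic to a matrix algebra $M_n(\mathbb{F})$ for some $n \ge 1$. The normalized rank of an element $a \in A$ is $\overline{r}(a) = r(a)/n$, where $A'$ is a subalgebra of $A$ with $1_A, a \in A'$ and $A' \cong M_n(\mathbb{F})$, and $r(a)$ is the rank of the matrix that corresponds to $a$ (this does not depend on the choice of $A'$ and of the isomorphism). Let $A$ and $B$ be unital locally matrix algebras over $\mathbb{F}$, and let $\varphi \colon A \to B$ be a surjective $\mathbb{F}$-linear mapping that preserves the normalized rank, that is, $\overline{r}(\varphi(a)) = \overline{r}(a)$ for all $a \in A$. Then there exist invertible elements $X, Y \in B$ and a mapping $\psi \colon A \to B$, which is an isomorphism or an anti-isomorphism of $\mathbb{F}$-algebras (a bijective linear mapping with $\psi(a_1a_2) = \psi(a_1)\psi(a_2)$ for all $a_1, a_2$, or with $\psi(a_1a_2) = \psi(a_2)\psi(a_1)$ for all $a_1, a_2$), such that $\varphi(a) = X\,\psi(a)\,Y$ for all $a \in A$. -/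

import Mathlib

/-- A matrix subalgebra of the unital `F`-algebra `A` around the element `a`: a subalgebra
`1 ∈ A' ⊆ A` with `a ∈ A'`, together with an isomorphism `A' ≅ M_n(F)`, where `n ≥ 1`. -/
structure MatrixSubalgebraAt (F : Type*) {A : Type*} [Field F] [Ring A] [Algebra F A]
    (a : A) where
  /-- the size of the matrices -/
  n : ℕ
  n_pos : 0 < n
  /-- the subalgebra -/
  carrier : Subalgebra F A
  mem : a ∈ carrier
  /-- the isomorphism with the matrix algebra -/
  iso : carrier ≃ₐ[F] Matrix (Fin n) (Fin n) F

/-- The number `r(a) / n` computed in one matrix subalgebra around `a`. -/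
noncomputable def MatrixSubalgebraAt.rankRatio {F A : Type*} [Field F] [Ring A] [Algebra F A]
    {a : A} (S : MatrixSubalgebraAt F a) : ℚ :=
  ((S.iso ⟨a, S.mem⟩).rank : ℚ) / (S.n : ℚ)

/-- A unital `F`-algebra `A` is locally matrix if every finite subset of `A` lies in a subalgebra
isomorphic to `M_n(F)` for some `n ≥ 1`. Here the subalgebras contain `1`: since `1` can be added
to the finite subset, this is no restriction in a unital algebra. -/
class IsLocallyMatrixAlgebra (F A : Type*) [Field F] [Ring A] [Algebra F A] : Prop where
  exists_subalgebra : ∀ s : Set A, s.Finite → ∃ (n : ℕ) (A' : Subalgebra F A),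
    0 < n ∧ s ⊆ (A' : Set A) ∧ Nonempty (A' ≃ₐ[F] Matrix (Fin n) (Fin n) F)

theorem nonempty_matrixSubalgebraAt (F : Type*) {A : Type*} [Field F] [Ring A] [Algebra F A]
    [IsLocallyMatrixAlgebra F A] (a : A) : Nonempty (MatrixSubalgebraAt F a) := by
  obtain ⟨n, A', hn, hs, ⟨f⟩⟩ :=
    IsLocallyMatrixAlgebra.exists_subalgebra (F := F) {a} (Set.finite_singleton a)
  exact ⟨⟨n, hn, A', hs rfl, f⟩⟩

/-- The normalized rank of an element `a` of a unital locally matrix algebra: choose a matrix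
subalgebra around `a` and take `r(a) / n` there. -/
noncomputable def normalizedRank (F : Type*) {A : Type*} [Field F] [Ring A] [Algebra F A]
    [IsLocallyMatrixAlgebra F A] (a : A) : ℚ :=
  (Classical.choice (nonempty_matrixSubalgebraAt F a)).rankRatio

/-- A linear map preserves the normalized rank. -/
def PreservesNormalizedRank {F A B : Type*} [Field F] [Ring A] [Algebra F A] [Ring B]
    [Algebra F B] [IsLocallyMatrixAlgebra F A] [IsLocallyMatrixAlgebra F B]
    (φ : A →ₗ[F] B) : Prop :=
  ∀ a : A, normalizedRank F (φ a) = normalizedRank F a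

/-- A bijective linear map is an isomorphism of algebras if it is multiplicative. -/
def IsAlgebraIso {F A B : Type*} [Field F] [Ring A] [Algebra F A] [Ring B] [Algebra F B]
    (ψ : A ≃ₗ[F] B) : Prop :=
  ∀ a₁ a₂ : A, ψ (a₁ * a₂) = ψ a₁ * ψ a₂

/-- A bijective linear map is an anti-isomorphism of algebras if it reverses products. -/
def IsAlgebraAntiIso {F A B : Type*} [Field F] [Ring A] [Algebra F A] [Ring B] [Algebra F B]
    (ψ : A ≃ₗ[F] B) : Prop :=
  ∀ a₁ a₂ : A, ψ (a₁ * a₂) = ψ a₂ * ψ a₁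

/-!
A linear bijection which preserves the normalized rank becomes, after multiplication by the inverse
of `φ 1`, a unital map `θ` with the same property. An element `e` is idempotent exactly when the
normalized ranks of `e` and `1 - e` add up to `1` (`mul_self_eq_iff_normalizedRank`), so `θ`
preserves idempotents. On a matrix algebra a linear map that preserves idempotents is a Jordan
homomorphism in characteristic different from `2` (`preservesJordanProduct_of_idem`): the quadratic
defect `θ(x²) - θ(x)²` vanishes on idempotents, and enough idempotents are built from matrix units
to make its polarization vanish on all pairs of matrix units. Since any two elements of `A` lie in
a matrix subalgebra, `θ` is a Jordan homomorphism on `A`.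

A locally matrix algebra is prime (`isPrimeRing_of_isLocallyMatrixAlgebra`), and by the
Herstein–Smiley theorem (`PreservesJordanProduct.map_mul_or_map_mul_rev`) a Jordan homomorphism onto
a prime algebra is a homomorphism or an antihomomorphism. Surjectivity matters here:
`a ↦ diag(a, aᵀ)` preserves the normalized rank and is neither. So `φ a = φ(1) θ(a)`.

The normalized rank is independent of choices (`MatrixSubalgebraAt.rankRatio_eq_normalizedRank`)
because a unital homomorphism of matrix algebras multiplies all ranks by the quotient of the sizes
(`Matrix.rank_algHom_mul_card`).
-/

/-! ### Ranks of square matrices -/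

namespace Matrix

variable {K m : Type*} [Field K] [Fintype m]

theorem mulVecLin_eq_zero_iff {a : Matrix m m K} : a.mulVecLin = 0 ↔ a = 0 := by
  classical
  rw [← toLin'_apply', LinearEquiv.map_eq_zero_iff]

theorem rank_add_le_add (a b : Matrix m m K) : (a + b).rank ≤ a.rank + b.rank := by
  rw [rank, rank, rank, mulVecLin_add]
  exact (Submodule.finrank_mono (LinearMap.range_add_le _ _)).trans
    (Submodule.finrank_add_le_finrank_add_finrank _ _)

theorem rank_units_mul_mul [DecidableEq m] {u v : Matrix m m K} (hu : IsUnit u) (hv : IsUnit v)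
    (a : Matrix m m K) : (u * a * v).rank = a.rank := by
  rw [rank_mul_eq_left_of_isUnit_det _ _ ((isUnit_iff_isUnit_det _).1 hv),
    rank_mul_eq_right_of_isUnit_det _ _ ((isUnit_iff_isUnit_det _).1 hu)]

theorem rank_eq_zero_iff {a : Matrix m m K} : a.rank = 0 ↔ a = 0 := by
  classical
  constructor
  · intro h
    rw [rank, Submodule.finrank_eq_zero, LinearMap.range_eq_bot] at h
    exact mulVecLin_eq_zero_iff.1 h
  · rintro rfl
    exact rank_zero

theorem isUnit_of_rank_eq_card [DecidableEq m] {a : Matrix m m K}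
    (h : a.rank = Fintype.card m) : IsUnit a := by
  have htop : LinearMap.range a.mulVecLin = ⊤ := by
    apply Submodule.eq_top_of_finrank_eq
    rw [← rank, h, Module.finrank_fintype_fun_eq_card]
  rw [← mulVec_surjective_iff_isUnit]
  exact LinearMap.range_eq_top.1 htop

theorem rank_add_of_orthogonal {e f : Matrix m m K} (he : e * e = e) (hf : f * f = f)
    (hef : e * f = 0) (hfe : f * e = 0) : (e + f).rank = e.rank + f.rank := by
  refine le_antisymm (rank_add_le_add e f) ?_
  have hdisj : LinearMap.range e.mulVecLin ⊓ LinearMap.range f.mulVecLin = ⊥ := by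
    rw [eq_bot_iff]
    rintro _ ⟨⟨x, rfl⟩, ⟨y, hy⟩⟩
    simp only [mulVecLin_apply] at hy ⊢
    rw [Submodule.mem_bot, ← he, ← mulVec_mulVec, ← hy, mulVec_mulVec, hef, zero_mulVec]
  have hle : LinearMap.range e.mulVecLin ⊔ LinearMap.range f.mulVecLin ≤
      LinearMap.range (e + f).mulVecLin := by
    refine sup_le ?_ ?_
    · rintro _ ⟨x, rfl⟩
      exact ⟨e *ᵥ x, by simp [mulVec_mulVec, he, hfe]⟩
    · rintro _ ⟨x, rfl⟩
      exact ⟨f *ᵥ x, by simp [mulVec_mulVec, hf, hef]⟩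
  have h := Submodule.finrank_sup_add_finrank_inf_eq
    (LinearMap.range e.mulVecLin) (LinearMap.range f.mulVecLin)
  rw [hdisj, finrank_bot, add_zero] at h
  rw [rank, rank, ← h]
  exact Submodule.finrank_mono hle

/-- A square matrix is idempotent exactly when its rank and the rank of its complement add up to
the size: the ranges of `a` and `1 - a` always span, so the equality says that they are disjoint,
and `a (1 - a) x` lies in both. -/
theorem isIdempotentElem_iff_rank [DecidableEq m] {a : Matrix m m K} :
    a * a = a ↔ a.rank + (1 - a).rank = Fintype.card m := by
  constructor
  · intro h
    rw [← rank_add_of_orthogonal h (by simp [mul_sub, sub_mul, h]) (by simp [mul_sub, h])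
      (by simp [sub_mul, h]), add_sub_cancel, rank_one]
  · intro h
    have hsup : LinearMap.range a.mulVecLin ⊔ LinearMap.range (1 - a).mulVecLin = ⊤ := by
      rw [eq_top_iff]
      intro x _
      refine Submodule.mem_sup.2 ⟨a *ᵥ x, ⟨x, rfl⟩, (1 - a) *ᵥ x, ⟨x, rfl⟩, ?_⟩
      rw [← add_mulVec, add_sub_cancel, one_mulVec]
    have hd := Submodule.finrank_sup_add_finrank_inf_eq
      (LinearMap.range a.mulVecLin) (LinearMap.range (1 - a).mulVecLin)
    rw [hsup, finrank_top, Module.finrank_fintype_fun_eq_card, ← rank, ← rank, h] at hd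
    have hbot := Submodule.finrank_eq_zero.1 (Nat.add_eq_left.1 hd)
    have hzero : a * (1 - a) = 0 := by
      refine mulVecLin_eq_zero_iff.1 (LinearMap.ext fun x => ?_)
      rw [LinearMap.zero_apply, mulVecLin_apply, ← Submodule.mem_bot K, ← hbot]
      refine ⟨⟨(1 - a) *ᵥ x, by rw [mulVecLin_apply, mulVec_mulVec]⟩, ⟨a *ᵥ x, ?_⟩⟩
      rw [mulVecLin_apply, mulVec_mulVec, mul_sub, sub_mul, mul_one, one_mul]
    rw [mul_sub, mul_one, sub_eq_zero] at hzero
    exact hzero.symm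

theorem rank_sum_of_orthogonal {ι : Type*} {e : ι → Matrix m m K}
    (he : ∀ i, e i * e i = e i) (horth : ∀ i j, i ≠ j → e i * e j = 0) (s : Finset ι) :
    (∑ i ∈ s, e i).rank = ∑ i ∈ s, (e i).rank := by
  classical
  have hidem : ∀ s : Finset ι, (∑ i ∈ s, e i) * (∑ i ∈ s, e i) = ∑ i ∈ s, e i := by
    intro s
    rw [Finset.sum_mul_sum]
    refine Finset.sum_congr rfl fun i hi => ?_
    rw [Finset.sum_eq_single_of_mem i hi fun j _ hj => horth i j hj.symm, he]
  induction s using Finset.induction_on with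
  | empty => simp
  | insert i s hi ih =>
    have hne : ∀ j ∈ s, i ≠ j := fun j hj h => hi (h ▸ hj)
    rw [Finset.sum_insert hi, Finset.sum_insert hi, ← ih]
    refine rank_add_of_orthogonal (he i) (hidem s) ?_ ?_
    · rw [Finset.mul_sum]
      exact Finset.sum_eq_zero fun j hj => horth i j (hne j hj)
    · rw [Finset.sum_mul]
      exact Finset.sum_eq_zero fun j hj => horth j i (hne j hj).symm

theorem sum_single_self {ι : Type*} [DecidableEq ι] (s : Finset ι) :
    (∑ i ∈ s, single i i 1 : Matrix ι ι K) = diagonal fun i => if i ∈ s then 1 else 0 := by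
  ext i j
  simp only [diagonal_apply, sum_apply, single_apply]
  by_cases hij : i = j
  · subst hij; simp
  · rw [if_neg hij, Finset.sum_eq_zero]
    rintro k -
    rw [if_neg]
    rintro ⟨rfl, rfl⟩
    exact hij rfl

theorem exists_units_mul_mul_eq_sum_single [DecidableEq m] (a : Matrix m m K) :
    ∃ (u v : Matrix m m K) (s : Finset m), IsUnit u ∧ IsUnit v ∧ s.card = a.rank ∧
      u * a * v = ∑ i ∈ s, single i i 1 := by
  classical
  obtain ⟨u, v, e, hu, hv, h⟩ := a.exists_rank_normal_form
  set s : Finset m := Finset.univ.filter fun i => (e i).isLeft with hs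
  have hdiag : u * a * v = diagonal fun i => if i ∈ s then 1 else 0 := by
    rw [h, ← diagonal_one, ← diagonal_zero, fromBlocks_diagonal, submatrix_diagonal_equiv]
    refine congrArg _ (funext fun i => ?_)
    rcases hi : e i with j | j <;> simp [hs, hi]
  refine ⟨u, v, s, hu, hv, ?_, ?_⟩
  · rw [← rank_units_mul_mul hu hv a, hdiag, rank_diagonal]
    simp
  · rw [hdiag, sum_single_self]

/-- A unital homomorphism of matrix algebras multiplies all ranks by the quotient of the sizes:
the diagonal matrix units go to orthogonal idempotents of the same rank with sum `1`. -/
theorem rank_algHom_mul_card {k : Type*} [Fintype k] [DecidableEq m] [DecidableEq k]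
    (f : Matrix m m K →ₐ[K] Matrix k k K) (a : Matrix m m K) :
    (f a).rank * Fintype.card m = a.rank * Fintype.card k := by
  rcases isEmpty_or_nonempty m with hm | ⟨⟨o⟩⟩
  · have ha : a.rank = 0 := Nat.le_zero.1 (a.rank_le_card_width.trans (by simp))
    simp [ha]
  have hle : ∀ i j, (f (single i i 1)).rank ≤ (f (single j j 1)).rank := by
    intro i j
    have h : (single i i 1 : Matrix m m K) = single i j 1 * single j j 1 * single j i 1 := by simp
    rw [h, map_mul, map_mul]
    exact (rank_mul_le_left _ _).trans (rank_mul_le_right _ _)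
  have hsum : ∀ s : Finset m,
      (f (∑ i ∈ s, single i i 1)).rank = s.card * (f (single o o 1)).rank := by
    intro s
    rw [map_sum, rank_sum_of_orthogonal]
    · rw [Finset.sum_congr rfl fun i _ => le_antisymm (hle i o) (hle o i), Finset.sum_const,
        smul_eq_mul]
    · intro i
      rw [← map_mul]; simp
    · intro i j hij
      rw [← map_mul, single_mul_single_of_ne _ _ _ _ hij, map_zero]
  obtain ⟨u, v, s, hu, hv, hcard, h⟩ := exists_units_mul_mul_eq_sum_single a
  have ha : (f a).rank = s.card * (f (single o o 1)).rank := by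
    rw [← hsum, ← h, map_mul, map_mul, rank_units_mul_mul (hu.map f) (hv.map f)]
  have hone : Fintype.card k = Fintype.card m * (f (single o o 1)).rank := by
    have h1 : (∑ i, single i i 1 : Matrix m m K) = 1 := by
      rw [sum_single_self]
      simp
    rw [← Finset.card_univ (α := m), ← hsum, h1, map_one, rank_one]
  rw [ha, hone, ← hcard]
  ring

end Matrix

/-! ### Jordan homomorphisms and idempotents -/

section Jordan

/-- A linear map of `F`-algebras is a Jordan homomorphism (for `2 ≠ 0`) if it preserves the
symmetrized product `x * y + y * x`. -/
def PreservesJordanProduct {F R S : Type*} [Field F] [Ring R] [Algebra F R] [Ring S]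
    [Algebra F S] (θ : R →ₗ[F] S) : Prop :=
  ∀ x y : R, θ (x * y + y * x) = θ x * θ y + θ y * θ x

variable {F R S : Type*} [Field F] [Ring R] [Algebra F R] [Ring S] [Algebra F S]

/-- The bilinear defect `θ(xy + yx) - (θ(x)θ(y) + θ(y)θ(x))` of a linear map `θ` from being a
Jordan homomorphism. -/
def jordanDefect (θ : R →ₗ[F] S) : R →ₗ[F] R →ₗ[F] S :=
  LinearMap.mk₂ F (fun x y => θ (x * y + y * x) - (θ x * θ y + θ y * θ x))
    (fun x x' y => by simp only [add_mul, mul_add, map_add]; abel)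
    (fun c x y => by
      simp only [smul_mul_assoc, mul_smul_comm, map_add, map_smul, smul_sub, smul_add])
    (fun x y y' => by simp only [add_mul, mul_add, map_add]; abel)
    (fun c x y => by
      simp only [smul_mul_assoc, mul_smul_comm, map_add, map_smul, smul_sub, smul_add])

theorem jordanDefect_apply (θ : R →ₗ[F] S) (x y : R) :
    jordanDefect θ x y = θ (x * y + y * x) - (θ x * θ y + θ y * θ x) := rfl

theorem jordanDefect_comm (θ : R →ₗ[F] S) (x y : R) :
    jordanDefect θ x y = jordanDefect θ y x := by
  rw [jordanDefect_apply, jordanDefect_apply, add_comm (x * y), add_comm (θ x * θ y)]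

theorem eq_zero_of_add_self (h2 : (2 : F) ≠ 0) {s : S} (h : s + s = 0) : s = 0 := by
  rw [← two_smul F s] at h
  exact (smul_eq_zero.1 h).resolve_left h2

variable {θ : R →ₗ[F] S} (hθ : ∀ e : R, e * e = e → θ e * θ e = θ e)

include hθ

theorem jordanDefect_idem {e : R} (he : e * e = e) : jordanDefect θ e e = 0 := by
  rw [jordanDefect_apply, he, hθ e he, map_add, sub_self]

/-- If `e`, `e + x` and `e - x` are idempotent, then `x` has no Jordan defect with `e` or itself. -/
theorem jordanDefect_of_idem (h2 : (2 : F) ≠ 0) {e x : R} (he : e * e = e)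
    (hp : (e + x) * (e + x) = e + x) (hm : (e - x) * (e - x) = e - x) :
    jordanDefect θ x x = 0 ∧ jordanDefect θ e x = 0 := by
  have h0 := jordanDefect_idem hθ he
  have h1 := jordanDefect_idem hθ hp
  have h3 := jordanDefect_idem hθ hm
  simp only [map_add, map_sub, LinearMap.add_apply, LinearMap.sub_apply, h0,
    jordanDefect_comm θ x e] at h1 h3
  rw [zero_add] at h1
  rw [zero_sub] at h3
  generalize jordanDefect θ x x = p at *
  generalize jordanDefect θ e x = q at *
  constructor
  · apply eq_zero_of_add_self h2
    rw [show p + p = (q + (q + p)) + (-q - (q - p)) by abel, h1, h3, add_zero]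
  · apply eq_zero_of_add_self h2
    apply eq_zero_of_add_self h2
    rw [show q + q + (q + q) = (q + (q + p)) - (-q - (q - p)) by abel, h1, h3, sub_zero]

theorem jordanDefect_upper (h2 : (2 : F) ≠ 0) {e x : R} (he : e * e = e) (hex : e * x = x)
    (hxe : x * e = 0) : jordanDefect θ x x = 0 ∧ jordanDefect θ e x = 0 := by
  have hxx : x * x = 0 := by
    calc x * x = x * (e * x) := by rw [hex]
      _ = 0 := by rw [← mul_assoc, hxe, zero_mul]
  apply jordanDefect_of_idem hθ h2 he
  · simp [mul_add, add_mul, he, hex, hxe, hxx]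
  · simp [mul_sub, sub_mul, he, hex, hxe, hxx]

theorem jordanDefect_lower (h2 : (2 : F) ≠ 0) {e x : R} (he : e * e = e) (hex : e * x = 0)
    (hxe : x * e = x) : jordanDefect θ x x = 0 ∧ jordanDefect θ e x = 0 := by
  have hxx : x * x = 0 := by
    calc x * x = (x * e) * x := by rw [hxe]
      _ = 0 := by rw [mul_assoc, hex, mul_zero]
  apply jordanDefect_of_idem hθ h2 he
  · simp [mul_add, add_mul, he, hex, hxe, hxx]
  · simp [mul_sub, sub_mul, he, hex, hxe, hxx]

theorem jordanDefect_upper_upper (h2 : (2 : F) ≠ 0) {e x y : R} (he : e * e = e)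
    (hex : e * x = x) (hxe : x * e = 0) (hey : e * y = y) (hye : y * e = 0) :
    jordanDefect θ x y = 0 := by
  have h := (jordanDefect_upper hθ h2 he (x := x + y) (by rw [mul_add, hex, hey])
    (by rw [add_mul, hxe, hye, add_zero])).1
  simp only [map_add, LinearMap.add_apply, (jordanDefect_upper hθ h2 he hex hxe).1,
    (jordanDefect_upper hθ h2 he hey hye).1, jordanDefect_comm θ y x, zero_add, add_zero] at h
  exact eq_zero_of_add_self h2 h

theorem jordanDefect_orthogonal (h2 : (2 : F) ≠ 0) {e f : R} (he : e * e = e) (hf : f * f = f)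
    (hef : e * f = 0) (hfe : f * e = 0) : jordanDefect θ e f = 0 := by
  have h := jordanDefect_idem hθ (e := e + f) (by simp [mul_add, add_mul, he, hf, hef, hfe])
  simp only [map_add, LinearMap.add_apply, jordanDefect_idem hθ he,
    jordanDefect_idem hθ hf, jordanDefect_comm θ f e, zero_add, add_zero] at h
  exact eq_zero_of_add_self h2 h

end Jordan

section MatrixUnits

open Matrix

variable {F S m : Type*} [Field F] [Ring S] [Algebra F S] [Fintype m] [DecidableEq m]
  {θ : Matrix m m F →ₗ[F] S} (hθ : ∀ e : Matrix m m F, e * e = e → θ e * θ e = θ e)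

include hθ

theorem jordanDefect_single_diag (h2 : (2 : F) ≠ 0) (i k l : m) :
    jordanDefect θ (single i i 1) (single k l 1) = 0 := by
  by_cases hkl : k = l
  · subst hkl
    by_cases hik : i = k
    · subst hik
      exact jordanDefect_idem hθ (by simp)
    · exact jordanDefect_orthogonal hθ h2 (by simp) (by simp) (by simp [hik])
        (by simp [Ne.symm hik])
  · by_cases hik : i = k
    · subst hik
      exact (jordanDefect_upper hθ h2 (by simp) (by simp) (by simp [Ne.symm hkl])).2
    · by_cases hil : i = l
      · subst hil
        exact (jordanDefect_lower hθ h2 (by simp) (by simp [hik]) (by simp)).2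
      · have h1 := (jordanDefect_upper hθ h2 (e := single k k 1) (x := single k l 1) (by simp)
          (by simp) (by simp [Ne.symm hkl])).2
        have h3 := (jordanDefect_upper hθ h2 (e := single i i 1 + single k k 1)
          (x := single k l 1) (by simp [mul_add, add_mul, hik, Ne.symm hik])
          (by simp [add_mul, hik]) (by simp [mul_add, Ne.symm hkl, Ne.symm hil])).2
        rwa [map_add, LinearMap.add_apply, h1, add_zero] at h3

theorem jordanDefect_single_offDiag (h2 : (2 : F) ≠ 0) {i j k l : m} (hij : i ≠ j) (hkl : k ≠ l)
    (hjk : j ≠ k) (hil : i ≠ l) :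
    jordanDefect θ (single i j 1) (single k l 1) = 0 := by
  by_cases hik : i = k
  · subst hik
    exact jordanDefect_upper_upper hθ h2 (e := single i i 1) (by simp) (by simp)
      (by simp [hij.symm]) (by simp) (by simp [hil.symm])
  · exact jordanDefect_upper_upper hθ h2 (e := single i i 1 + single k k 1)
      (by simp [mul_add, add_mul, hik, Ne.symm hik]) (by simp [add_mul, Ne.symm hik])
      (by simp [mul_add, hij.symm, hjk]) (by simp [add_mul, hik])
      (by simp [mul_add, hkl.symm, hil.symm])

/-- The rank one idempotent `(e_i + e_j)(e_j + e_l)ᵀ` has all four of its matrix units as terms;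
all pairs of them but `E_{ij}, E_{jl}` are known to have no defect. -/
theorem jordanDefect_single_chain (h2 : (2 : F) ≠ 0) {i j l : m} (hij : i ≠ j) (hjl : j ≠ l)
    (hil : i ≠ l) : jordanDefect θ (single i j 1) (single j l 1) = 0 := by
  have h := jordanDefect_idem hθ
    (e := single j j 1 + single i j 1 + single j l 1 + single i l 1)
    (by simp [mul_add, add_mul, hij.symm, hjl.symm, hil.symm]; abel)
  have hd := jordanDefect_single_diag hθ h2 j
  have hd' := fun k l => (jordanDefect_comm θ (single k l 1) (single j j 1)).trans (hd k l)
  simp only [map_add, LinearMap.add_apply, hd, hd',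
    jordanDefect_single_offDiag hθ h2 hij hij hij.symm hij,
    jordanDefect_single_offDiag hθ h2 hij hil hij.symm hil,
    jordanDefect_single_offDiag hθ h2 hjl hjl hjl.symm hjl,
    jordanDefect_single_offDiag hθ h2 hjl hil hil.symm hjl,
    jordanDefect_single_offDiag hθ h2 hil hij hil.symm hij,
    jordanDefect_single_offDiag hθ h2 hil hjl hjl.symm hil,
    jordanDefect_single_offDiag hθ h2 hil hil hil.symm hil,
    jordanDefect_comm θ (single j l 1) (single i j 1), zero_add, add_zero] at h
  exact eq_zero_of_add_self h2 h

/-- The rank one idempotent `(2e_i + e_j)(e_i - e_j)ᵀ` has nonzero coefficients at `E_{ij}` and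
`E_{ji}` because `2 ≠ 0`. -/
theorem jordanDefect_single_transpose (h2 : (2 : F) ≠ 0) {i j : m} (hij : i ≠ j) :
    jordanDefect θ (single i j 1) (single j i 1) = 0 := by
  have h := jordanDefect_idem hθ
    (e := (2 : F) • single i i 1 - (2 : F) • single i j 1 + single j i 1 - single j j 1)
    (by
      simp only [mul_add, add_mul, mul_sub, sub_mul, smul_mul_assoc, mul_smul_comm,
        single_mul_single_same, single_mul_single_of_ne _ _ _ _ hij,
        single_mul_single_of_ne _ _ _ _ hij.symm, mul_one]
      module)
  have hd := jordanDefect_single_diag hθ h2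
  have hd' := fun j k l => (jordanDefect_comm θ (single k l 1) (single j j 1)).trans (hd j k l)
  simp only [map_add, map_sub, map_smul, LinearMap.add_apply, LinearMap.sub_apply,
    LinearMap.smul_apply, hd, hd',
    jordanDefect_single_offDiag hθ h2 hij hij hij.symm hij,
    jordanDefect_single_offDiag hθ h2 hij.symm hij.symm hij hij.symm,
    jordanDefect_comm θ (single j i 1) (single i j 1), smul_zero, zero_add, add_zero, sub_zero,
    zero_sub, ← neg_add, neg_eq_zero] at h
  rw [← smul_add] at h
  exact eq_zero_of_add_self h2 ((smul_eq_zero.1 h).resolve_left h2)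

theorem jordanDefect_single (h2 : (2 : F) ≠ 0) (i j k l : m) :
    jordanDefect θ (single i j 1) (single k l 1) = 0 := by
  by_cases hij : i = j
  · subst hij
    exact jordanDefect_single_diag hθ h2 i k l
  by_cases hkl : k = l
  · subst hkl
    rw [jordanDefect_comm]
    exact jordanDefect_single_diag hθ h2 k i j
  by_cases hjk : j = k
  · subst hjk
    by_cases hil : i = l
    · subst hil
      exact jordanDefect_single_transpose hθ h2 hij
    · exact jordanDefect_single_chain hθ h2 hij hkl hil
  · by_cases hil : i = l
    · subst hil
      rw [jordanDefect_comm]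
      exact jordanDefect_single_chain hθ h2 hkl hij (Ne.symm hjk)
    · exact jordanDefect_single_offDiag hθ h2 hij hkl hjk hil

/-- In characteristic different from `2`, a linear map from a matrix algebra that preserves
idempotents is a Jordan homomorphism. -/
theorem preservesJordanProduct_of_idem (h2 : (2 : F) ≠ 0) : PreservesJordanProduct θ := by
  have h : jordanDefect θ = 0 := by
    refine ext_linearMap _ fun i j => LinearMap.ext_ring (ext_linearMap _ fun k l =>
      LinearMap.ext_ring ?_)
    exact jordanDefect_single hθ h2 i j k l
  intro x y
  rw [← sub_eq_zero, ← jordanDefect_apply, h]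
  rfl

end MatrixUnits

/-! ### Jordan homomorphisms onto prime rings -/

section Prime

variable {R S : Type*} [Ring R] [Ring S]

/-- A ring is prime if `x S y = 0` forces `x = 0` or `y = 0`. The zero ring is not excluded. -/
def IsPrimeRing (S : Type*) [Ring S] : Prop :=
  ∀ x y : S, (∀ c, x * c * y = 0) → x = 0 ∨ y = 0

/-- In a prime ring without `2`-torsion the identity `x c y + y c x = 0` forces `x = 0` or `y = 0`:
moving `y` past `x` in `x c x d y` in two ways gives `2 x c y d x = 0`. -/
theorem IsPrimeRing.eq_zero_or_eq_zero_of_symm (hS : IsPrimeRing S)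
    (h2 : ∀ s : S, s + s = 0 → s = 0) {x y : S} (h : ∀ c, x * c * y + y * c * x = 0) :
    x = 0 ∨ y = 0 := by
  have hxy : ∀ c d, x * c * (y * d * x) = 0 := by
    intro c d
    apply h2
    have h1 := h (c * x * d)
    have h3 : x * c * (x * d * y + y * d * x) = 0 := by rw [h, mul_zero]
    have h4 : (x * c * y + y * c * x) * d * x = 0 := by rw [h, zero_mul, zero_mul]
    calc x * c * (y * d * x) + x * c * (y * d * x)
        = x * c * (x * d * y + y * d * x) + (x * c * y + y * c * x) * d * x
          - (x * (c * x * d) * y + y * (c * x * d) * x) := by noncomm_ring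
      _ = 0 := by rw [h1, h3, h4]; simp
  by_cases hx : x = 0
  · exact Or.inl hx
  · refine Or.inr ((hS y x fun d => ?_).resolve_right hx)
    exact (hS x (y * d * x) fun c => hxy c d).resolve_left hx

/-- If at each pair one of the biadditive maps `f` and `g` vanishes, then one of them vanishes at
all pairs, because an additive group is not the union of two proper subgroups. -/
theorem forall_eq_zero_or_forall_eq_zero {G H : Type*} [AddCommGroup G] [AddCommGroup H]
    (f g : G →+ G →+ H) (h : ∀ x y, f x y = 0 ∨ g x y = 0) :
    (∀ x y, f x y = 0) ∨ ∀ x y, g x y = 0 := by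
  have hunion : ∀ p q : G →+ H, (∀ y, p y = 0 ∨ q y = 0) → p = 0 ∨ q = 0 := by
    intro p q hpq
    by_contra! hne
    obtain ⟨⟨a, ha⟩, ⟨b, hb⟩⟩ := DFunLike.ne_iff.1 hne.1, DFunLike.ne_iff.1 hne.2
    rw [AddMonoidHom.zero_apply] at ha hb
    have hqa := (hpq a).resolve_left ha
    have hpb := (hpq b).resolve_right hb
    rcases hpq (a + b) with h | h <;> simp_all
  have hrow : ∀ x, f x = 0 ∨ g x = 0 := fun x => hunion _ _ (h x)
  by_contra! hne
  obtain ⟨⟨a, c, hac⟩, ⟨b, d, hbd⟩⟩ := hne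
  have ha : f a ≠ 0 := fun h => hac (by rw [h, AddMonoidHom.zero_apply])
  have hb : g b ≠ 0 := fun h => hbd (by rw [h, AddMonoidHom.zero_apply])
  have hga := (hrow a).resolve_left ha
  have hfb := (hrow b).resolve_right hb
  rcases hrow (a + b) with h | h <;> simp_all

end Prime

section HersteinSmiley

variable {F R S : Type*} [Field F] [Ring R] [Algebra F R] [Ring S] [Algebra F S]
  {θ : R →ₗ[F] S}

theorem PreservesJordanProduct.map_sandwich (h2 : (2 : F) ≠ 0) (hθ : PreservesJordanProduct θ)
    (a b : R) : θ (a * b * a) = θ a * θ b * θ a := by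
  rw [← sub_eq_zero]
  apply eq_zero_of_add_self h2
  have h1 := hθ a (a * b + b * a)
  have h3 := hθ (a * a) b
  have h4 : θ (a * a) + θ (a * a) = θ a * θ a + θ a * θ a := by rw [← map_add, hθ]
  have h5 : θ (a * a) = θ a * θ a := by
    rw [← sub_eq_zero]
    apply eq_zero_of_add_self h2
    rw [← sub_eq_zero] at h4
    rw [← h4]; abel
  rw [show a * (a * b + b * a) + (a * b + b * a) * a =
    (a * a * b + b * (a * a)) + (a * b * a + a * b * a) by noncomm_ring, map_add, h3, h5,
    hθ a b, map_add] at h1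
  rw [show θ (a * b * a) - θ a * θ b * θ a + (θ (a * b * a) - θ a * θ b * θ a) =
    (θ a * θ a * θ b + θ b * (θ a * θ a) + (θ (a * b * a) + θ (a * b * a))) -
      (θ a * (θ a * θ b + θ b * θ a) + (θ a * θ b + θ b * θ a) * θ a) by noncomm_ring, h1, sub_self]

theorem PreservesJordanProduct.map_triple (h2 : (2 : F) ≠ 0) (hθ : PreservesJordanProduct θ)
    (a b c : R) : θ (a * b * c + c * b * a) = θ a * θ b * θ c + θ c * θ b * θ a := by
  have h := hθ.map_sandwich h2 (a + c) b
  rw [show (a + c) * b * (a + c) = a * b * a + (a * b * c + c * b * a) + c * b * c by noncomm_ring,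
    map_add, map_add, hθ.map_sandwich h2, hθ.map_sandwich h2, map_add θ a c,
    map_add] at h
  rw [map_add, ← sub_eq_zero, ← sub_eq_zero.2 h]
  noncomm_ring

/-- The two multiplicative defects of a Jordan homomorphism annihilate each other, in the sense
needed for prime rings. Both sides come from the two ways of reading
`(ab)c(ba) + (ba)c(ab) = a(bcb)a + b(aca)b`. -/
theorem PreservesJordanProduct.defect_mul_defect (h2 : (2 : F) ≠ 0)
    (hθ : PreservesJordanProduct θ) (a b c : R) :
    (θ (a * b) - θ a * θ b) * θ c * (θ (a * b) - θ b * θ a) +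
      (θ (a * b) - θ b * θ a) * θ c * (θ (a * b) - θ a * θ b) = 0 := by
  have h1 := hθ.map_triple h2 (a * b) c (b * a)
  rw [show a * b * c * (b * a) + b * a * c * (a * b) =
    a * (b * c * b) * a + b * (a * c * a) * b by noncomm_ring, map_add, hθ.map_sandwich h2,
    hθ.map_sandwich h2, hθ.map_sandwich h2, hθ.map_sandwich h2] at h1
  have h3 : θ (b * a) = θ a * θ b + θ b * θ a - θ (a * b) := by
    rw [← hθ, map_add]; abel
  rw [h3, ← sub_eq_zero] at h1
  rw [← h1]
  noncomm_ring

/-- The Herstein–Smiley theorem: a Jordan homomorphism onto a prime algebra is a homomorphism or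
an antihomomorphism. -/
theorem PreservesJordanProduct.map_mul_or_map_mul_rev (h2 : (2 : F) ≠ 0)
    (hθ : PreservesJordanProduct θ) (hsurj : Function.Surjective θ) (hS : IsPrimeRing S) :
    (∀ a b, θ (a * b) = θ a * θ b) ∨ ∀ a b, θ (a * b) = θ b * θ a := by
  let f : R →+ R →+ S := AddMonoidHom.mk' (fun a => AddMonoidHom.mk'
    (fun b => θ (a * b) - θ a * θ b) (fun b b' => by simp only [mul_add, map_add]; abel))
    (fun a a' => by
      ext b
      simp only [AddMonoidHom.mk'_apply, AddMonoidHom.add_apply, add_mul, map_add]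
      abel)
  let g : R →+ R →+ S := AddMonoidHom.mk' (fun a => AddMonoidHom.mk'
    (fun b => θ (a * b) - θ b * θ a) (fun b b' => by simp only [mul_add, add_mul, map_add]; abel))
    (fun a a' => by
      ext b
      simp only [AddMonoidHom.mk'_apply, AddMonoidHom.add_apply, add_mul, mul_add, map_add]
      abel)
  have h : ∀ a b, f a b = 0 ∨ g a b = 0 := by
    intro a b
    refine hS.eq_zero_or_eq_zero_of_symm (fun s => eq_zero_of_add_self h2) fun s => ?_
    obtain ⟨c, rfl⟩ := hsurj s
    exact hθ.defect_mul_defect h2 a b c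
  exact (forall_eq_zero_or_forall_eq_zero f g h).imp
    (fun h a b => sub_eq_zero.1 (h a b)) (fun h a b => sub_eq_zero.1 (h a b))

end HersteinSmiley

/-! ### The normalized rank in locally matrix algebras -/

section LocallyMatrix

variable {F A : Type*} [Field F] [Ring A] [Algebra F A]

theorem MatrixSubalgebraAt.rankRatio_eq_of_le {a : A} (S T : MatrixSubalgebraAt F a)
    (h : S.carrier ≤ T.carrier) : S.rankRatio = T.rankRatio := by
  let f : Matrix (Fin S.n) (Fin S.n) F →ₐ[F] Matrix (Fin T.n) (Fin T.n) F :=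
    (T.iso : T.carrier →ₐ[F] _).comp
      ((Subalgebra.inclusion h).comp (S.iso.symm : _ →ₐ[F] S.carrier))
  have hf : f (S.iso ⟨a, S.mem⟩) = T.iso ⟨a, T.mem⟩ := by simp [f]
  have hrank := Matrix.rank_algHom_mul_card f (S.iso ⟨a, S.mem⟩)
  rw [hf, Fintype.card_fin, Fintype.card_fin] at hrank
  have hS : (S.n : ℚ) ≠ 0 := Nat.cast_ne_zero.2 S.n_pos.ne'
  have hT : (T.n : ℚ) ≠ 0 := Nat.cast_ne_zero.2 T.n_pos.ne'
  rw [rankRatio, rankRatio, div_eq_div_iff hS hT]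
  exact_mod_cast hrank.symm

variable [IsLocallyMatrixAlgebra F A]

/-- Any two matrix subalgebras are finite-dimensional, so they lie in a third one. -/
theorem MatrixSubalgebraAt.exists_ge {a : A} (S T : MatrixSubalgebraAt F a) :
    ∃ U : MatrixSubalgebraAt F a, S.carrier ≤ U.carrier ∧ T.carrier ≤ U.carrier := by
  have hfg : ∀ S : MatrixSubalgebraAt F a, ∃ s : Finset A,
      Submodule.span F (s : Set A) = Subalgebra.toSubmodule S.carrier := by
    intro S
    have : Module.Finite F S.carrier := Module.Finite.equiv S.iso.symm.toLinearEquiv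
    exact (Module.Finite.iff_fg (N := Subalgebra.toSubmodule S.carrier)).1 this
  obtain ⟨s, hs⟩ := hfg S
  obtain ⟨t, ht⟩ := hfg T
  obtain ⟨n, U, hn, hU, ⟨g⟩⟩ := IsLocallyMatrixAlgebra.exists_subalgebra (F := F)
    ((s : Set A) ∪ t) (s.finite_toSet.union t.finite_toSet)
  have hS : S.carrier ≤ U := by
    rw [← OrderEmbedding.le_iff_le Subalgebra.toSubmodule, ← hs, Submodule.span_le]
    exact Set.subset_union_left.trans hU
  have hT : T.carrier ≤ U := by
    rw [← OrderEmbedding.le_iff_le Subalgebra.toSubmodule, ← ht, Submodule.span_le]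
    exact Set.subset_union_right.trans hU
  exact ⟨⟨n, hn, U, hS S.mem, g⟩, hS, hT⟩

/-- The normalized rank does not depend on the matrix subalgebra in which it is computed. -/
theorem MatrixSubalgebraAt.rankRatio_eq_normalizedRank {a : A} (S : MatrixSubalgebraAt F a) :
    S.rankRatio = normalizedRank F a := by
  obtain ⟨U, hS, hT⟩ := S.exists_ge (Classical.choice (nonempty_matrixSubalgebraAt F a))
  rw [normalizedRank, rankRatio_eq_of_le S U hS, rankRatio_eq_of_le _ U hT]

variable (F) in
/-- Every finite set lies in one matrix subalgebra, which computes the normalized ranks of all its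
elements. -/
theorem exists_matrix_normalizedRank_eq {s : Set A} (hs : s.Finite) :
    ∃ (n : ℕ) (T : Subalgebra F A) (g : T ≃ₐ[F] Matrix (Fin n) (Fin n) F), 0 < n ∧ s ⊆ T ∧
      ∀ x : T, normalizedRank F (x : A) = ((g x).rank : ℚ) / n := by
  obtain ⟨n, T, hn, hT, ⟨g⟩⟩ := IsLocallyMatrixAlgebra.exists_subalgebra (F := F) s hs
  exact ⟨n, T, g, hn, hT, fun x =>
    (MatrixSubalgebraAt.rankRatio_eq_normalizedRank ⟨n, hn, T, x.2, g⟩).symm⟩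

theorem normalizedRank_zero : normalizedRank F (0 : A) = 0 := by
  obtain ⟨n, T, g, -, -, hr⟩ := exists_matrix_normalizedRank_eq F (Set.finite_singleton (0 : A))
  rw [← ZeroMemClass.coe_zero T, hr, map_zero, Matrix.rank_zero, Nat.cast_zero, zero_div]

theorem eq_zero_of_normalizedRank_eq_zero {a : A} (h : normalizedRank F a = 0) : a = 0 := by
  obtain ⟨n, T, g, hn, hT, hr⟩ := exists_matrix_normalizedRank_eq F (Set.finite_singleton a)
  have hn' : (n : ℚ) ≠ 0 := Nat.cast_ne_zero.2 hn.ne'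
  have h1 := hr ⟨a, hT rfl⟩
  rw [h, eq_comm, div_eq_zero_iff, or_iff_left hn', Nat.cast_eq_zero, Matrix.rank_eq_zero_iff,
    EmbeddingLike.map_eq_zero_iff] at h1
  exact congrArg Subtype.val h1

theorem normalizedRank_one : normalizedRank F (1 : A) = 1 := by
  obtain ⟨n, T, g, hn, hT, hr⟩ := exists_matrix_normalizedRank_eq F (Set.finite_singleton (1 : A))
  have hn' : (n : ℚ) ≠ 0 := Nat.cast_ne_zero.2 hn.ne'
  rw [← OneMemClass.coe_one T, hr, map_one, Matrix.rank_one, Fintype.card_fin, div_self hn']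

theorem isUnit_of_normalizedRank_eq_one {a : A} (h : normalizedRank F a = 1) : IsUnit a := by
  obtain ⟨n, T, g, hn, hT, hr⟩ := exists_matrix_normalizedRank_eq F (Set.finite_singleton a)
  have hn' : (n : ℚ) ≠ 0 := Nat.cast_ne_zero.2 hn.ne'
  have h1 := hr ⟨a, hT rfl⟩
  rw [h, eq_comm, div_eq_one_iff_eq hn', Nat.cast_inj] at h1
  have h3 := Matrix.isUnit_of_rank_eq_card (h1.trans (Fintype.card_fin n).symm)
  have h4 := (h3.map g.symm).map T.val
  simpa using h4

theorem normalizedRank_units_mul (u : Aˣ) (a : A) :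
    normalizedRank F (u * a) = normalizedRank F a := by
  obtain ⟨n, T, g, hn, hT, hr⟩ :=
    exists_matrix_normalizedRank_eq F (Set.toFinite {(u : A), ((u⁻¹ : Aˣ) : A), a})
  have hu : (u : A) ∈ T := hT (by simp)
  have hu' : ((u⁻¹ : Aˣ) : A) ∈ T := hT (by simp)
  have ha : a ∈ T := hT (by simp)
  have hunit : IsUnit (⟨u, hu⟩ : T) :=
    ⟨⟨⟨u, hu⟩, ⟨_, hu'⟩, Subtype.ext u.mul_inv, Subtype.ext u.inv_mul⟩, rfl⟩
  have h1 := hr (⟨u, hu⟩ * ⟨a, ha⟩)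
  rw [map_mul, Matrix.rank_mul_eq_right_of_isUnit_det _ _
    ((Matrix.isUnit_iff_isUnit_det _).1 (hunit.map g)), ← hr] at h1
  exact h1

theorem mul_self_eq_iff_normalizedRank {a : A} :
    a * a = a ↔ normalizedRank F a + normalizedRank F (1 - a) = 1 := by
  obtain ⟨n, T, g, hn, hT, hr⟩ := exists_matrix_normalizedRank_eq F (Set.finite_singleton a)
  have hn' : (n : ℚ) ≠ 0 := Nat.cast_ne_zero.2 hn.ne'
  have ha : a ∈ T := hT rfl
  have h0 := hr ⟨a, ha⟩
  have h1 := hr (1 - ⟨a, ha⟩)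
  have hmul : a * a = a ↔ g ⟨a, ha⟩ * g ⟨a, ha⟩ = g ⟨a, ha⟩ := by
    rw [← map_mul, g.injective.eq_iff, Subtype.ext_iff]
    rfl
  rw [map_sub, map_one] at h1
  rw [hmul, Matrix.isIdempotentElem_iff_rank, Fintype.card_fin,
    show normalizedRank F (1 - a) = _ from h1, show normalizedRank F a = _ from h0, ← add_div,
    div_eq_one_iff_eq hn']
  exact_mod_cast Iff.rfl

/-- Nonzero `x` and `y` lie in a common matrix algebra, where some matrix unit separates them. -/
theorem isPrimeRing_of_isLocallyMatrixAlgebra (F A : Type*) [Field F] [Ring A] [Algebra F A]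
    [IsLocallyMatrixAlgebra F A] : IsPrimeRing A := by
  intro x y h
  obtain ⟨n, T, g, hn, hT, -⟩ := exists_matrix_normalizedRank_eq F (Set.toFinite {x, y})
  have hx : x ∈ T := hT (by simp)
  have hy : y ∈ T := hT (by simp)
  have hzero : ∀ c, g ⟨x, hx⟩ * c * g ⟨y, hy⟩ = 0 := by
    intro c
    have h1 : (⟨x, hx⟩ * g.symm c * ⟨y, hy⟩ : T) = 0 := Subtype.ext (h _)
    simpa using congrArg g h1
  by_contra! hne
  have hx' : g ⟨x, hx⟩ ≠ 0 := fun h0 => hne.1 (congrArg Subtype.val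
    (EmbeddingLike.map_eq_zero_iff.1 h0))
  have hy' : g ⟨y, hy⟩ ≠ 0 := fun h0 => hne.2 (congrArg Subtype.val
    (EmbeddingLike.map_eq_zero_iff.1 h0))
  obtain ⟨i, j, hij⟩ : ∃ i j, g ⟨x, hx⟩ i j ≠ 0 := by
    by_contra! h0
    exact hx' (Matrix.ext h0)
  obtain ⟨k, l, hkl⟩ : ∃ k l, g ⟨y, hy⟩ k l ≠ 0 := by
    by_contra! h0
    exact hy' (Matrix.ext h0)
  have h1 := congrFun (congrFun (hzero (Matrix.single j k 1)) i) l
  rw [Matrix.mul_assoc, Matrix.mul_apply, Finset.sum_eq_single j, Matrix.single_mul_apply_same,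
    one_mul, Matrix.zero_apply] at h1
  · exact (mul_ne_zero hij hkl) h1
  · intro b _ hb
    rw [Matrix.single_mul_apply_of_ne _ _ _ _ _ hb, mul_zero]
  · simp

/-- A linear map from a locally matrix algebra that preserves idempotents is a Jordan homomorphism,
since two given elements lie in a common matrix subalgebra. -/
theorem IsLocallyMatrixAlgebra.preservesJordanProduct_of_idem {S : Type*} [Ring S] [Algebra F S]
    (h2 : (2 : F) ≠ 0) {θ : A →ₗ[F] S} (hθ : ∀ e : A, e * e = e → θ e * θ e = θ e) :
    PreservesJordanProduct θ := by
  intro x y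
  obtain ⟨n, T, hn, hT, ⟨g⟩⟩ :=
    IsLocallyMatrixAlgebra.exists_subalgebra (F := F) {x, y} (Set.toFinite _)
  let f : Matrix (Fin n) (Fin n) F →ₐ[F] A := T.val.comp (g.symm : _ →ₐ[F] T)
  have hx : f (g ⟨x, hT (by simp)⟩) = x := by simp [f]
  have hy : f (g ⟨y, hT (by simp)⟩) = y := by simp [f]
  have h := _root_.preservesJordanProduct_of_idem (θ := θ ∘ₗ f.toLinearMap)
    (fun e he => hθ (f e) (by rw [← map_mul, he])) h2 (g ⟨x, hT (by simp)⟩) (g ⟨y, hT (by simp)⟩)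
  simpa only [LinearMap.comp_apply, AlgHom.toLinearMap_apply, map_add, map_mul, hx, hy] using h

end LocallyMatrix

/-! ### Rank-preserving surjections -/

theorem corollary1 {F A B : Type*} [Field F] (hF : ringChar F ≠ 2)
    [Ring A] [Algebra F A] [IsLocallyMatrixAlgebra F A]
    [Ring B] [Algebra F B] [IsLocallyMatrixAlgebra F B]
    (φ : A →ₗ[F] B) (hsurj : Function.Surjective φ) (hrank : PreservesNormalizedRank φ) :
    ∃ (ψ : A ≃ₗ[F] B) (X Y : Bˣ), (IsAlgebraIso ψ ∨ IsAlgebraAntiIso ψ) ∧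
      ∀ a : A, φ a = (X : B) * ψ a * (Y : B) := by
  have h2 : (2 : F) ≠ 0 := Ring.two_ne_zero hF
  obtain ⟨u, hu⟩ : IsUnit (φ 1) :=
    isUnit_of_normalizedRank_eq_one ((hrank 1).trans normalizedRank_one)
  let θ : A →ₗ[F] B := LinearMap.mulLeft F ((u⁻¹ : Bˣ) : B) ∘ₗ φ
  have hθ : ∀ a, θ a = ((u⁻¹ : Bˣ) : B) * φ a := fun a => rfl
  have hφ : ∀ a, φ a = u * θ a := fun a => by rw [hθ, Units.mul_inv_cancel_left]
  have hθrank : ∀ a, normalizedRank F (θ a) = normalizedRank F a := fun a => by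
    rw [hθ, normalizedRank_units_mul, hrank]
  have hθone : θ 1 = 1 := by rw [hθ, ← hu, Units.inv_mul]
  have hinj : Function.Injective θ := by
    rw [injective_iff_map_eq_zero]
    intro a ha
    exact eq_zero_of_normalizedRank_eq_zero (F := F) (by rw [← hθrank, ha, normalizedRank_zero])
  have hθsurj : Function.Surjective θ := by
    intro b
    obtain ⟨a, ha⟩ := hsurj (u * b)
    exact ⟨a, by rw [hθ, ha, Units.inv_mul_cancel_left]⟩
  have hbij : Function.Bijective θ := ⟨hinj, hθsurj⟩
  have hidem : ∀ e : A, e * e = e → θ e * θ e = θ e := by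
    intro e he
    rw [mul_self_eq_iff_normalizedRank (F := F), ← hθone, ← map_sub, hθrank, hθrank]
    exact mul_self_eq_iff_normalizedRank.1 he
  have hjordan := IsLocallyMatrixAlgebra.preservesJordanProduct_of_idem h2 hidem
  refine ⟨LinearEquiv.ofBijective θ hbij, u, 1,
    hjordan.map_mul_or_map_mul_rev h2 hθsurj (isPrimeRing_of_isLocallyMatrixAlgebra F B), ?_⟩
  intro a
  rw [Units.val_one, mul_one]
  exact hφ a
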